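/- Let $n\ge 1$. Let $\mathcal M_0(\mathbb R^n)$ be the set of complex Borel measures $\mu$ on $\mathbb R^n$ such that $\iint \bigl|\ln|x-y|\bigr|\,d|\mu|(y)\,d|\mu|(x)<\infty$, where $|\mu|$ is the total variation of $\mu$, $|\cdot|$ is the Euclidean norm and $|\ln 0|=\infty$, and let $\mathcal M_{00}(\mathbb R^n)=\{\mu\in\mathcal M_0(\mathbb R^n):\mu(\mathbb R^n)=0\}$. For $\mu\in\mathcal M_0(\mathbb R^n)$ let $$I(\mu)=\int p_\mu\,d\bar\mu,\qquad p_\mu(x)=\int \ln\frac1{|x-y|}\,d\mu(y),$$ be its logarithmic energy, where $\bar\mu(A)=\overline{\mu(A)}$, let $\widehat\mu(\xi)=\int e^{i\xi\cdot x}\,d\mu(x)$ be its Fourier transform, and let $\omega_{n-1}=2\pi^{n/2}/\Gamma(n/2)$ be the area of the unit sphere of $\mathbb R^n$. Let $\mu\in\mathcal M_0(\mathbb R^n)$. Then $\widehat\mu\in L^2(d\xi/|\xi|^n)$ if and only if $\mu\in\mathcal M_{00}(\mathbb R^n)$, and in this case $$\omega_{n-1}I(\mu)=\|\widehat\mu\|^2_{L^2(d\xi/|\xi|^n)}.$$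 Consequently logarithmic energy is positive definite on $\mathcal M_{00}(\mathbb R^n)$: for every $\mu\in\mathcal M_{00}(\mathbb R^n)$ the number $I(\mu)$ is real and nonnegative, and $I(\mu)=0$ if and only if $\mu=0$. -/

import Mathlib

open MeasureTheory

noncomputable section

namespace LogEnergy

/-- The kernel `|ln |x - y||` with values in `[0, ∞]`; it is `∞` on the diagonal `x = y`. -/
def absLogKernel {n : ℕ} (x y : EuclideanSpace ℝ (Fin n)) : ENNReal :=
  (ENNReal.log (edist x y)).abs

/-- `𝓜₀(ℝⁿ)`: the complex Borel measures `μ` on `ℝⁿ` with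
`∫∫ |ln |x - y|| d|μ|(y) d|μ|(x) < ∞`, where `|μ|` is the total variation of `μ`. -/
def M0 (n : ℕ) : Set (ComplexMeasure (EuclideanSpace ℝ (Fin n))) :=
  {μ | ∫⁻ x, ∫⁻ y, absLogKernel x y ∂μ.variation ∂μ.variation < ⊤}

/-- `𝓜₀₀(ℝⁿ)`: the measures in `𝓜₀(ℝⁿ)` with vanishing total mass. -/
def M00 (n : ℕ) : Set (ComplexMeasure (EuclideanSpace ℝ (Fin n))) :=
  {μ | μ ∈ M0 n ∧ μ Set.univ = 0}

/-- The integral `∫ f dμ` of a complex function against a complex measure, that is, Mathlib's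
integral against a vector measure for the multiplication of complex numbers. -/
def cintegral {n : ℕ} (μ : ComplexMeasure (EuclideanSpace ℝ (Fin n)))
    (f : EuclideanSpace ℝ (Fin n) → ℂ) : ℂ :=
  μ.integral f (ContinuousLinearMap.mul ℝ ℂ)

/-- The conjugate measure, `A ↦ conj (μ A)`. -/
def conjMeasure {n : ℕ} (μ : ComplexMeasure (EuclideanSpace ℝ (Fin n))) :
    ComplexMeasure (EuclideanSpace ℝ (Fin n)) :=
  μ.mapRange (starRingEnd ℂ).toAddMonoidHom Complex.continuous_conj

/-- The logarithmic potential `p_μ(x) = ∫ ln (1 / |x - y|) dμ(y)`. For `μ ∈ 𝓜₀(ℝⁿ)` the integral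
converges absolutely and `|μ|({x}) = 0` for `|μ|`-almost every `x`, so that the value of the
integrand at `y = x` is irrelevant. -/
def logPotential {n : ℕ} (μ : ComplexMeasure (EuclideanSpace ℝ (Fin n)))
    (x : EuclideanSpace ℝ (Fin n)) : ℂ :=
  cintegral μ (fun y => ((Real.log (1 / ‖x - y‖) : ℝ) : ℂ))

/-- The logarithmic energy `I(μ) = ∫ p_μ(x) d(conj μ)(x)`. -/
def logEnergy {n : ℕ} (μ : ComplexMeasure (EuclideanSpace ℝ (Fin n))) : ℂ :=
  cintegral (conjMeasure μ) (logPotential μ)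

/-- The Fourier transform `ξ ↦ ∫ exp (i ξ · x) dμ(x)`. -/
def fourierTransform {n : ℕ} (μ : ComplexMeasure (EuclideanSpace ℝ (Fin n)))
    (ξ : EuclideanSpace ℝ (Fin n)) : ℂ :=
  cintegral μ (fun x => Complex.exp (Complex.I * ((inner ℝ ξ x : ℝ) : ℂ)))

/-- The measure `dξ / |ξ|ⁿ` on `ℝⁿ`. -/
def invNormPowMeasure (n : ℕ) : Measure (EuclideanSpace ℝ (Fin n)) :=
  volume.withDensity (fun ξ => ENNReal.ofReal (1 / ‖ξ‖ ^ n))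

/-- `ω_{n-1} = 2 π^{n/2} / Γ(n/2)`, the area of the unit sphere of `ℝⁿ`. -/
def sphereArea (n : ℕ) : ℝ :=
  2 * Real.pi ^ ((n : ℝ) / 2) / Real.Gamma ((n : ℝ) / 2)

end LogEnergy

end

/-! Superpose Gaussians. Write `E(t) = ∬ exp(-|x-y|²/(4t)) dμ(y) dμ̄(x)`. Since `Γ(n/2) |ξ|⁻ⁿ = ∫₀^∞
t^(n/2-1) exp(-t|ξ|²) dt`, and the Fourier transform of a Gaussian turns `∫ exp(-t|ξ|²) |μ̂(ξ)|² dξ`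
into `(π/t)^(n/2) E(t)`, Tonelli gives `∫ |μ̂|² dξ/|ξ|ⁿ = π^(n/2)/Γ(n/2) · ∫₀^∞ E(t) dt/t` in `[0,
∞]`, for every finite complex measure (`lintegral_densityFourier`).

As `t → ∞`, `E(t) → |μ(ℝⁿ)|²`, and `dt/t` has infinite mass at infinity, so finiteness forces `μ(ℝⁿ)
= 0`. Conversely, if the mass vanishes, `exp(-a/t)` may be replaced by `exp(-a/t) - 1_{t>1}` without
changing `E`. The new kernel is integrable against `dt/t`, with integral `c - ln a` and `L¹` norm at
most `c' + |ln a|`. With `a = |x-y|²/4`, finite logarithmic energy justifies Fubini, the constants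
cancel against the zero mass, and `∫₀^∞ E(t) dt/t = 2 I(μ)` (`integrable_heatEnergy`).

If `I(μ) = 0`, then `μ̂` vanishes almost everywhere, hence everywhere by continuity, and `μ = 0` by
uniqueness of characteristic functions. -/

noncomputable section

namespace LogEnergy

open Set Filter
open scoped ComplexConjugate Topology

/-! ### The regularised integral of `exp(-a/t)` against `dt/t`. -/

/-- The heat kernel profile `exp (-a / t)`, cut off at large times, against `dt / t`. -/
def cutKernel (a t : ℝ) : ℝ := t⁻¹ * (Real.exp (-(a / t)) - if 1 < t then 1 else 0)

lemma measurable_cutKernel : Measurable (fun p : ℝ × ℝ => cutKernel p.1 p.2) := by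
  unfold cutKernel
  refine Measurable.mul (by fun_prop) (Measurable.sub (by fun_prop) ?_)
  exact Measurable.ite (measurableSet_lt measurable_const measurable_snd) measurable_const
    measurable_const

/-- On `(0, 1]`, `exp(1/t) ≥ 1/t` bounds the kernel by `1`; beyond `1`, `1 - exp(-1/t) ≤ 1/t` bounds
it by `t⁻²`. -/
lemma integrableOn_cutKernel_one : IntegrableOn (cutKernel 1) (Ioi 0) := by
  have hm : Measurable (cutKernel 1) := measurable_cutKernel.comp measurable_prodMk_left
  rw [← Ioc_union_Ioi_eq_Ioi zero_le_one, integrableOn_union]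
  constructor
  · refine Integrable.mono' (g := fun _ => (1 : ℝ)) (integrableOn_const (by simp)) hm.aestronglyMeasurable ?_
    refine ae_restrict_of_forall_mem measurableSet_Ioc fun t ht => ?_
    rw [cutKernel, if_neg (not_lt.2 ht.2), sub_zero, Real.norm_eq_abs,
      abs_of_nonneg (by have := ht.1; positivity), one_div, Real.exp_neg, ← mul_inv]
    have h1 := Real.add_one_le_exp t⁻¹
    have h2 : t * t⁻¹ = 1 := mul_inv_cancel₀ ht.1.ne'
    apply inv_le_one_of_one_le₀
    nlinarith [ht.1]
  · refine Integrable.mono' (integrableOn_Ioi_rpow_of_lt (a := -2) (by norm_num) one_pos)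
      hm.aestronglyMeasurable ?_
    refine ae_restrict_of_forall_mem measurableSet_Ioi fun t (ht : 1 < t) => ?_
    have ht0 : 0 < t := by linarith
    have h1 := Real.add_one_le_exp (-(1 / t))
    have h2 : Real.exp (-(1 / t)) ≤ 1 := Real.exp_le_one_iff.2 (by
      rw [neg_nonpos]; positivity)
    rw [cutKernel, if_pos ht, norm_mul, Real.norm_eq_abs, Real.norm_eq_abs,
      abs_of_pos (inv_pos.2 ht0), abs_of_nonpos (by linarith)]
    have : t ^ (-2 : ℝ) = t⁻¹ * (1 / t) := by
      rw [Real.rpow_neg ht0.le, one_div, ← mul_inv]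
      norm_num [sq]
    rw [this]
    gcongr
    linarith

/-- The difference of two logarithmic cutoffs. -/
def cutDiff (a t : ℝ) : ℝ := t⁻¹ * ((if a < t then 1 else 0) - if 1 < t then 1 else 0)

lemma integrableOn_inv_Ioc {a b : ℝ} (ha : 0 < a) : IntegrableOn (fun t : ℝ => t⁻¹) (Ioc a b) := by
  refine (ContinuousOn.integrableOn_Icc ?_).mono_set Ioc_subset_Icc_self
  exact continuousOn_inv₀.mono fun t ht => (ha.trans_le ht.1).ne'

/-- The function is `±1/t` on the interval between `a` and `1` and zero elsewhere. Its sign is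
constant, so the integral and the `L¹` norm are both explicit logarithms. -/
lemma cutDiff_integral {a : ℝ} (ha : 0 < a) :
    IntegrableOn (cutDiff a) (Ioi 0) ∧ ∫ t in Ioi 0, cutDiff a t = -Real.log a ∧
      ∫ t in Ioi 0, ‖cutDiff a t‖ = |Real.log a| := by
  have aux : ∀ {b c : ℝ}, 0 < b → b ≤ c → ∀ σ : ℝ,
      IntegrableOn ((Ioc b c).indicator fun t => σ * t⁻¹) (Ioi 0) ∧
      ∫ t in Ioi 0, (Ioc b c).indicator (fun t => σ * t⁻¹) t = σ * Real.log (c / b) := by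
    intro b c hb hbc σ
    constructor
    · exact (((integrable_indicator_iff measurableSet_Ioc).2
        ((integrableOn_inv_Ioc hb).const_mul σ))).integrableOn
    · rw [setIntegral_indicator measurableSet_Ioc, inter_eq_self_of_subset_right, integral_const_mul,
        ← intervalIntegral.integral_of_le hbc, integral_inv_of_pos hb (hb.trans_le hbc)]
      exact fun t ht => hb.trans ht.1
  have hn : ∀ (b c t : ℝ), 0 < b → ∀ σ : ℝ, ‖(Ioc b c).indicator (fun t => σ * t⁻¹) t‖ =
      (Ioc b c).indicator (fun t => |σ| * t⁻¹) t := by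
    intro b c t hb σ
    by_cases ht : t ∈ Ioc b c
    · rw [indicator_of_mem ht, indicator_of_mem ht, norm_mul, Real.norm_eq_abs, Real.norm_eq_abs,
        abs_of_pos (inv_pos.2 (hb.trans ht.1))]
    · rw [indicator_of_notMem ht, indicator_of_notMem ht, norm_zero]
  rcases le_total a 1 with h1 | h1
  · have e : cutDiff a = (Ioc a 1).indicator fun t => 1 * t⁻¹ := by
      ext t
      by_cases h2 : a < t <;> by_cases h3 : 1 < t <;>
        simp [cutDiff, indicator, h2, h3, not_lt.1, not_le.2]; grind
    rw [e]
    refine ⟨(aux ha h1 1).1, ?_, ?_⟩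
    · rw [(aux ha h1 1).2]; simp
    · simp_rw [hn _ _ _ ha]
      rw [(aux ha h1 _).2, abs_of_nonpos (Real.log_nonpos ha.le h1)]; simp
  · have e : cutDiff a = (Ioc 1 a).indicator fun t => (-1) * t⁻¹ := by
      ext t
      by_cases h2 : a < t <;> by_cases h3 : 1 < t <;>
        simp [cutDiff, indicator, h2, h3, not_lt.1, not_le.2]; grind
    rw [e]
    refine ⟨(aux one_pos h1 _).1, ?_, ?_⟩
    · rw [(aux one_pos h1 _).2]; simp
    · simp_rw [hn _ _ _ one_pos]
      rw [(aux one_pos h1 _).2, abs_of_nonneg (Real.log_nonneg h1)]; simp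

/-- The measure `dt/t` is scale invariant, so rescaling by `a` affects only the cutoff, which moves
from `1` to `a`. All dependence on `a` thus sits in `cutDiff`. -/
lemma cutKernel_eq {a : ℝ} (ha : 0 < a) (t : ℝ) :
    cutKernel a t = a⁻¹ * cutKernel 1 (a⁻¹ * t) + cutDiff a t := by
  have h : 1 < a⁻¹ * t ↔ a < t := by
    rw [inv_mul_eq_div, one_lt_div ha]
  have h2 : (1 : ℝ) / (a⁻¹ * t) = a / t := by field_simp
  have h3 : a⁻¹ * (a⁻¹ * t)⁻¹ = t⁻¹ := by field_simp
  simp only [cutKernel, cutDiff, h, h2]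
  rw [← mul_assoc, h3]
  ring

lemma integrableOn_cutKernel {a : ℝ} (ha : 0 < a) : IntegrableOn (cutKernel a) (Ioi 0) := by
  have h1 : IntegrableOn (fun t => cutKernel 1 (a⁻¹ * t)) (Ioi 0) :=
    (integrableOn_Ioi_comp_mul_left_iff _ _ (inv_pos.2 ha)).2 (by
      simpa using integrableOn_cutKernel_one)
  exact ((h1.const_mul a⁻¹).add (cutDiff_integral ha).1).congr
    (Eventually.of_forall fun t => (cutKernel_eq ha t).symm)

lemma integral_cutKernel {a : ℝ} (ha : 0 < a) :
    ∫ t in Ioi 0, cutKernel a t = (∫ t in Ioi 0, cutKernel 1 t) - Real.log a := by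
  have h1 : IntegrableOn (fun t => cutKernel 1 (a⁻¹ * t)) (Ioi 0) :=
    (integrableOn_Ioi_comp_mul_left_iff _ _ (inv_pos.2 ha)).2 (by
      simpa using integrableOn_cutKernel_one)
  simp_rw [cutKernel_eq ha]
  rw [integral_add (h1.const_mul a⁻¹) (cutDiff_integral ha).1, (cutDiff_integral ha).2.1,
    integral_const_mul, integral_comp_mul_left_Ioi _ _ (inv_pos.2 ha)]
  simp [ha.ne', sub_eq_add_neg]

lemma integral_norm_cutKernel_le {a : ℝ} (ha : 0 < a) :
    ∫ t in Ioi 0, ‖cutKernel a t‖ ≤ (∫ t in Ioi 0, ‖cutKernel 1 t‖) + |Real.log a| := by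
  have h1 : IntegrableOn (fun t => ‖cutKernel 1 (a⁻¹ * t)‖) (Ioi 0) :=
    (integrableOn_Ioi_comp_mul_left_iff (fun t => ‖cutKernel 1 t‖) _ (inv_pos.2 ha)).2 (by
      simpa only [mul_zero] using! integrableOn_cutKernel_one.norm)
  calc ∫ t in Ioi 0, ‖cutKernel a t‖
      ≤ ∫ t in Ioi 0, (a⁻¹ * ‖cutKernel 1 (a⁻¹ * t)‖ + ‖cutDiff a t‖) := by
        refine integral_mono (integrableOn_cutKernel ha).norm
          ((h1.const_mul a⁻¹).add (cutDiff_integral ha).1.norm) fun t => ?_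
        rw [cutKernel_eq ha]
        refine (norm_add_le _ _).trans_eq ?_
        rw [norm_mul, Real.norm_of_nonneg (inv_pos.2 ha).le]
    _ = _ := by
        rw [integral_add (h1.const_mul a⁻¹) (cutDiff_integral ha).1.norm, (cutDiff_integral ha).2.2,
          integral_const_mul,
          integral_comp_mul_left_Ioi (fun t => ‖cutKernel 1 t‖) _ (inv_pos.2 ha)]
        simp [ha.ne']

/-! ### Polar decomposition and integration against a complex measure. -/

section Polar

variable {α : Type*} [MeasurableSpace α]

/-- The sum of the total variations of the real and imaginary parts dominates `μ`; normalising the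
density of `μ` with respect to it gives the phase. -/
lemma exists_polar_decomposition (μ : ComplexMeasure α) :
    IsFiniteMeasure μ.variation ∧ ∃ h : α → ℂ, Measurable h ∧ (∀ x, ‖h x‖ ≤ 1) ∧
      μ = μ.variation.withDensityᵥ h := by
  set ν₀ : Measure α := (ComplexMeasure.re μ).totalVariation + (ComplexMeasure.im μ).totalVariation
  have : IsFiniteMeasure ν₀ := by infer_instance
  set g : α → ℂ := ComplexMeasure.rnDeriv μ ν₀ with hg
  have hgi : Integrable g ν₀ := ComplexMeasure.integrable_rnDeriv _ _
  have hgm : Measurable g := by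
    have h1 := SignedMeasure.measurable_rnDeriv (ComplexMeasure.re μ) ν₀
    have h2 := SignedMeasure.measurable_rnDeriv (ComplexMeasure.im μ) ν₀
    have : g = fun x => ((ComplexMeasure.re μ).rnDeriv ν₀ x : ℂ) +
        ((ComplexMeasure.im μ).rnDeriv ν₀ x : ℂ) * Complex.I := by
      ext x
      simp only [hg, ComplexMeasure.rnDeriv]
      apply Complex.ext <;> simp
    rw [this]
    fun_prop
  have hac : ∀ s : SignedMeasure α, s.totalVariation ≤ ν₀ → ν₀.withDensityᵥ (s.rnDeriv ν₀) = s := by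
    intro s hs
    apply SignedMeasure.withDensityᵥ_rnDeriv_eq
    refine VectorMeasure.AbsolutelyContinuous.mk fun i hi hi0 => ?_
    rw [Measure.toENNRealVectorMeasure_apply_measurable hi] at hi0
    apply SignedMeasure.null_of_totalVariation_zero
    exact le_antisymm (hi0 ▸ hs i) (zero_le)
  have hre := hac (ComplexMeasure.re μ) (Measure.le_add_right le_rfl)
  have him := hac (ComplexMeasure.im μ) (Measure.le_add_left le_rfl)
  have hμ : μ = ν₀.withDensityᵥ g := by
    ext i hi
    rw [withDensityᵥ_apply hgi hi]
    apply Complex.ext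
    · have := congrArg (fun v : SignedMeasure α => v i) hre
      simp only [withDensityᵥ_apply (SignedMeasure.integrable_rnDeriv _ _) hi] at this
      have h2 := setIntegral_re_add_im (hgi.integrableOn (s := i))
      rw [← h2]
      simpa [hg, ComplexMeasure.rnDeriv] using! this.symm
    · have := congrArg (fun v : SignedMeasure α => v i) him
      simp only [withDensityᵥ_apply (SignedMeasure.integrable_rnDeriv _ _) hi] at this
      have h2 := setIntegral_re_add_im (hgi.integrableOn (s := i))
      rw [← h2]
      simpa [hg, ComplexMeasure.rnDeriv] using! this.symm
  have hvar : μ.variation = ν₀.withDensity (fun x => ‖g x‖ₑ) := by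
    rw [hμ]; exact Measure.variation_withDensityᵥ hgi
  have hfin : IsFiniteMeasure μ.variation := by
    rw [hvar]
    exact isFiniteMeasure_withDensity hgi.2.ne
  -- Where `g` vanishes the convention `0⁻¹ = 0` gives phase `0`, so the bound by `1` holds at every
  -- point.
  refine ⟨hfin, fun x => ‖g x‖⁻¹ • g x, by fun_prop, fun x => ?_, ?_⟩
  · rw [norm_smul, norm_inv, norm_norm]
    exact inv_mul_le_one
  · rw [hvar, ← withDensityᵥ_smul_eq_withDensityᵥ_withDensity']
    · conv_lhs => rw [hμ]
      congr 1
      ext x : 1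
      rcases eq_or_ne (g x) 0 with hx | hx
      · simp [hx]
      · simp only [toReal_enorm]
        rw [smul_smul, mul_inv_cancel₀ (by simpa using hx), one_smul]
    · exact hgm.enorm.aemeasurable
    · exact Eventually.of_forall fun x => by simp
    · refine hgi.congr (Eventually.of_forall fun x => ?_)
      rcases eq_or_ne (g x) 0 with hx | hx
      · simp [hx]
      · simp only [toReal_enorm]
        rw [smul_smul, mul_inv_cancel₀ (by simpa using hx), one_smul]

lemma variation_withDensityᵥ_le {ν : Measure α} {h : α → ℂ} (hi : Integrable h ν)
    (hb : ∀ x, ‖h x‖ ≤ 1) : (ν.withDensityᵥ h).variation ≤ ν := by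
  rw [Measure.variation_withDensityᵥ hi]
  calc ν.withDensity (fun x => ‖h x‖ₑ) ≤ ν.withDensity 1 := by
        refine withDensity_mono (Eventually.of_forall fun x => ?_)
        exact enorm_le_coe.2 (hb x)
    _ = ν := withDensity_one

/-- Both sides agree on indicators, are additive, and are Lipschitz for the `L¹(ν)` distance because
`‖h‖ ≤ 1`. -/
lemma integral_withDensityᵥ {ν : Measure α} [IsFiniteMeasure ν] {h : α → ℂ}
    (hm : Measurable h) (hb : ∀ x, ‖h x‖ ≤ 1) {f : α → ℂ} (hf : Integrable f ν) :
    (ν.withDensityᵥ h).integral f (ContinuousLinearMap.mul ℝ ℂ) = ∫ x, f x * h x ∂ν := by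
  have hi : Integrable h ν := Integrable.of_bound hm.aestronglyMeasurable 1
    (Eventually.of_forall hb)
  have hle := variation_withDensityᵥ_le hi hb
  have hfm : ∀ {f : α → ℂ}, Integrable f ν → Integrable (fun x => f x * h x) ν := fun hf =>
    hf.mul_bdd (c := 1) hm.aestronglyMeasurable (Eventually.of_forall hb)
  refine Integrable.induction (P := fun f => (ν.withDensityᵥ h).integral f
    (ContinuousLinearMap.mul ℝ ℂ) = ∫ x, f x * h x ∂ν) ?_ ?_ ?_ ?_ hf
  · intro c s hs hs'
    have hfin : (ν.withDensityᵥ h).variation s ≠ ⊤ := ((hle s).trans_lt hs').ne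
    rw [VectorMeasure.integral, setToFun_indicator_const _ hs hfin]
    change ContinuousLinearMap.mul ℝ ℂ c ((ν.withDensityᵥ h) s) = _
    rw [withDensityᵥ_apply hi hs, ContinuousLinearMap.mul_apply', ← integral_const_mul,
      ← integral_indicator hs]
    congr 1
    ext x
    by_cases hx : x ∈ s <;> simp [hx]
  · intro f g _ hf hg ihf ihg
    rw [VectorMeasure.integral_add (hf.mono_measure hle) (hg.mono_measure hle), ihf, ihg,
      ← integral_add (hfm hf) (hfm hg)]
    simp [add_mul]
  · apply isClosed_eq
    · refine LipschitzWith.continuous (K := ‖ContinuousLinearMap.mul ℝ ℂ‖₊) fun f g => ?_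
      refine (VectorMeasure.edist_integral_le_lintegral_edist
        ((L1.integrable_coeFn f).mono_measure hle) ((L1.integrable_coeFn g).mono_measure hle)).trans ?_
      rw [L1.edist_def]
      exact mul_le_mul_right (lintegral_mono' hle le_rfl) _
    · refine LipschitzWith.continuous (K := 1) fun f g => ?_
      rw [edist_eq_enorm_sub, ← integral_sub (hfm (L1.integrable_coeFn f))
        (hfm (L1.integrable_coeFn g)), L1.edist_def]
      refine (enorm_integral_le_lintegral_enorm _).trans ?_
      rw [ENNReal.coe_one, one_mul]
      refine lintegral_mono fun x => ?_
      rw [← sub_mul, enorm_mul, edist_eq_enorm_sub]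
      exact mul_le_of_le_one_right' (enorm_le_coe.2 (hb x))
  · intro f g hfg hf ih
    rw [← VectorMeasure.integral_congr_ae (Measure.absolutelyContinuous_of_le hle hfg), ih]
    apply integral_congr_ae
    filter_upwards [hfg] with x hx
    rw [hx]

lemma conj_withDensityᵥ {ν : Measure α} {h : α → ℂ} (hi : Integrable h ν) :
    (ν.withDensityᵥ h).mapRange (starRingEnd ℂ).toAddMonoidHom Complex.continuous_conj =
      ν.withDensityᵥ (fun x => (starRingEnd ℂ) (h x)) := by
  have hi' : Integrable (fun x => (starRingEnd ℂ) (h x)) ν :=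
    (Complex.conjLIE.toContinuousLinearEquiv.integrable_comp_iff).2 hi
  ext s hs
  rw [VectorMeasure.mapRange_apply, withDensityᵥ_apply hi hs, withDensityᵥ_apply hi' hs]
  exact integral_conj.symm

end Polar

/-! ### Fourier transforms of densities and their injectivity. -/

variable {n : ℕ} {ν : Measure (EuclideanSpace ℝ (Fin n))}
  {h : EuclideanSpace ℝ (Fin n) → ℂ}

/-- The Fourier transform of the measure with density `h` with respect to `ν`. -/
def densityFourier (ν : Measure (EuclideanSpace ℝ (Fin n))) (h : EuclideanSpace ℝ (Fin n) → ℂ)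
    (ξ : EuclideanSpace ℝ (Fin n)) : ℂ :=
  ∫ x, Complex.exp (Complex.I * ((inner ℝ ξ x : ℝ) : ℂ)) * h x ∂ν

lemma norm_exp_I_mul_ofReal (t : ℝ) : ‖Complex.exp (Complex.I * (t : ℂ))‖ = 1 := by
  rw [mul_comm, Complex.norm_exp_ofReal_mul_I]

lemma continuous_densityFourier (hi : Integrable h ν) : Continuous (densityFourier ν h) := by
  refine continuous_of_dominated (bound := fun x => ‖h x‖) (fun ξ => ?_) (fun ξ => ?_) hi.norm ?_
  · exact (Continuous.aestronglyMeasurable (by fun_prop)).mul hi.aestronglyMeasurable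
  · exact Eventually.of_forall fun x => by
      rw [norm_mul, norm_exp_I_mul_ofReal, one_mul]
  · exact Eventually.of_forall fun x => by fun_prop

lemma fourierTransform_withDensityᵥ [IsFiniteMeasure ν] (hm : Measurable h) (hb : ∀ x, ‖h x‖ ≤ 1) :
    fourierTransform (ν.withDensityᵥ h) = densityFourier ν h := by
  ext ξ
  refine integral_withDensityᵥ hm hb (Integrable.of_bound
    (Continuous.aestronglyMeasurable (by fun_prop)) 1 (Eventually.of_forall fun x => ?_))
  exact (norm_exp_I_mul_ofReal _).le

/-- A real density whose Fourier transform vanishes is null. -/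
lemma ae_eq_zero_of_densityFourier_ofReal_eq_zero {g : EuclideanSpace ℝ (Fin n) → ℝ} (hg : Integrable g ν)
    (h0 : ∀ ξ, densityFourier ν (fun x => (g x : ℂ)) ξ = 0) : g =ᵐ[ν] 0 := by
  have e1 : IsFiniteMeasure (ν.withDensity fun x => ENNReal.ofReal (g x)) :=
    isFiniteMeasure_withDensity_ofReal hg.2
  have e2 : IsFiniteMeasure (ν.withDensity fun x => ENNReal.ofReal (-g x)) :=
    isFiniteMeasure_withDensity_ofReal hg.neg.2
  -- The positive and negative parts of `g` define finite measures whose characteristic functions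
  -- coincide.
  have key : (ν.withDensity fun x => ENNReal.ofReal (g x)) =
      ν.withDensity fun x => ENNReal.ofReal (-g x) := by
    apply Measure.ext_of_charFun
    ext ξ
    rw [charFun_apply, charFun_apply,
      integral_withDensity_eq_integral_toReal_smul₀ hg.aemeasurable.ennreal_ofReal (by simp),
      integral_withDensity_eq_integral_toReal_smul₀
        (f := fun x => ENNReal.ofReal (-g x)) hg.neg.aemeasurable.ennreal_ofReal (by simp),
      ← sub_eq_zero, ← integral_sub, ← h0 ξ, densityFourier]
    · congr 1
      ext x
      have hx : (ENNReal.ofReal (g x)).toReal - (ENNReal.ofReal (-g x)).toReal = g x := by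
        rw [ENNReal.toReal_ofReal', ENNReal.toReal_ofReal']
        rcases le_total 0 (g x) with h | h <;> simp [h]
      rw [← sub_smul, hx, mul_comm Complex.I, real_inner_comm, mul_comm, Complex.real_smul,
        mul_comm]
    · refine Integrable.smul_bdd (φ := fun x => (ENNReal.ofReal (g x)).toReal) ?_ 1
        (Continuous.aestronglyMeasurable (by fun_prop))
        (Eventually.of_forall fun x => (Complex.norm_exp_ofReal_mul_I _).le)
      simpa only [ENNReal.toReal_ofReal'] using! hg.pos_part
    · refine Integrable.smul_bdd (φ := fun x => (ENNReal.ofReal (-g x)).toReal) ?_ 1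
        (Continuous.aestronglyMeasurable (by fun_prop))
        (Eventually.of_forall fun x => (Complex.norm_exp_ofReal_mul_I _).le)
      simpa only [ENNReal.toReal_ofReal'] using! hg.neg.pos_part
  have h3 := (withDensity_eq_iff hg.aemeasurable.ennreal_ofReal hg.neg.aemeasurable.ennreal_ofReal
    (by simpa using (measure_lt_top (ν.withDensity fun x => ENNReal.ofReal (g x)) Set.univ).ne)).1 key
  filter_upwards [h3] with x hx
  have hx' : ENNReal.ofReal (g x) = ENNReal.ofReal (-g x) := hx
  rcases le_total 0 (g x) with h | h
  · rw [ENNReal.ofReal_of_nonpos (neg_nonpos.2 h), ENNReal.ofReal_eq_zero] at hx'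
    exact le_antisymm hx' h
  · rw [ENNReal.ofReal_of_nonpos h, eq_comm, ENNReal.ofReal_eq_zero, neg_nonpos] at hx'
    exact le_antisymm h hx'

/-- The transform of `conj h` at `ξ` is the conjugate of that of `h` at `-ξ`. Both vanish, hence so
do the transforms of the real and imaginary parts. -/
lemma ae_eq_zero_of_densityFourier_eq_zero (hi : Integrable h ν)
    (h0 : ∀ ξ, densityFourier ν h ξ = 0) : h =ᵐ[ν] 0 := by
  have hi' : Integrable (fun x => (starRingEnd ℂ) (h x)) ν :=
    (Complex.conjLIE.toContinuousLinearEquiv.integrable_comp_iff).2 hi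
  have hint : ∀ (ξ) {f : EuclideanSpace ℝ (Fin n) → ℂ}, Integrable f ν →
      Integrable (fun x => Complex.exp (Complex.I * ((inner ℝ ξ x : ℝ) : ℂ)) * f x) ν :=
    fun ξ f hf => hf.bdd_mul (c := 1) (Continuous.aestronglyMeasurable (by fun_prop))
      (Eventually.of_forall fun x => (norm_exp_I_mul_ofReal _).le)
  have h1 : ∀ ξ, densityFourier ν (fun x => (starRingEnd ℂ) (h x)) ξ = 0 := by
    intro ξ
    have := congrArg (starRingEnd ℂ) (h0 (-ξ))
    rw [densityFourier, ← integral_conj] at this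
    rw [densityFourier, ← map_zero (starRingEnd ℂ), ← this]
    congr 1
    ext x
    rw [map_mul, ← Complex.exp_conj, map_mul, Complex.conj_I, Complex.conj_ofReal, inner_neg_left]
    push_cast
    ring_nf
  have hre : (fun x => (h x).re) =ᵐ[ν] 0 := by
    refine ae_eq_zero_of_densityFourier_ofReal_eq_zero hi.re fun ξ => ?_
    have : ∀ x, (((h x).re : ℝ) : ℂ) = (1 / 2 : ℂ) * (h x + (starRingEnd ℂ) (h x)) := fun x => by
      rw [Complex.add_conj]; push_cast; ring
    simp only [densityFourier, this, mul_left_comm _ (1 / 2 : ℂ), integral_const_mul]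
    simp only [mul_add]
    rw [integral_add (hint ξ hi) (hint ξ hi')]
    have a := h0 ξ
    have b := h1 ξ
    simp only [densityFourier] at a b
    rw [a, b]; simp
  have him : (fun x => (h x).im) =ᵐ[ν] 0 := by
    refine ae_eq_zero_of_densityFourier_ofReal_eq_zero hi.im fun ξ => ?_
    have : ∀ x, (((h x).im : ℝ) : ℂ) = (-Complex.I / 2 : ℂ) * (h x - (starRingEnd ℂ) (h x)) :=
      fun x => by
        rw [Complex.sub_conj]; push_cast; linear_combination ((h x).im : ℂ) * Complex.I_sq
    simp only [densityFourier, this, mul_left_comm _ (-Complex.I / 2 : ℂ), integral_const_mul]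
    simp only [mul_sub]
    rw [integral_sub (hint ξ hi) (hint ξ hi')]
    have a := h0 ξ
    have b := h1 ξ
    simp only [densityFourier] at a b
    rw [a, b]; simp
  filter_upwards [hre, him] with x h1 h2
  exact Complex.ext h1 h2

/-! ### Heat energy and logarithmic energy as double integrals. -/

/-- The density of `μ ⊗ conj μ` with respect to `ν ⊗ ν`, with the variable of `conj μ` first. -/
def pairDensity (h : EuclideanSpace ℝ (Fin n) → ℂ)
    (p : EuclideanSpace ℝ (Fin n) × EuclideanSpace ℝ (Fin n)) : ℂ := conj (h p.1) * h p.2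

/-- The squared distance, normalised as it appears in the heat kernel. -/
def quarterSqDist (p : EuclideanSpace ℝ (Fin n) × EuclideanSpace ℝ (Fin n)) : ℝ :=
  ‖p.1 - p.2‖ ^ 2 / 4

/-- The heat energy `∬ exp (-|x - y|² / (4t)) dμ(y) d(conj μ)(x)`. -/
def heatEnergy (ν : Measure (EuclideanSpace ℝ (Fin n))) (h : EuclideanSpace ℝ (Fin n) → ℂ)
    (t : ℝ) : ℂ :=
  ∫ p, (Real.exp (-(quarterSqDist p / t)) : ℂ) * pairDensity h p ∂(ν.prod ν)

lemma measurable_pairDensity (hm : Measurable h) : Measurable (pairDensity h) := by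
  unfold pairDensity
  exact (Complex.continuous_conj.measurable.comp (hm.comp measurable_fst)).mul
    (hm.comp measurable_snd)

lemma norm_pairDensity_le (hb : ∀ x, ‖h x‖ ≤ 1)
    (p : EuclideanSpace ℝ (Fin n) × EuclideanSpace ℝ (Fin n)) : ‖pairDensity h p‖ ≤ 1 := by
  rw [pairDensity, norm_mul, RCLike.norm_conj]
  exact mul_le_one₀ (hb _) (norm_nonneg _) (hb _)

@[fun_prop]
lemma measurable_quarterSqDist : Measurable (quarterSqDist (n := n)) := by
  unfold quarterSqDist
  fun_prop

lemma quarterSqDist_nonneg (p : EuclideanSpace ℝ (Fin n) × EuclideanSpace ℝ (Fin n)) :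
    0 ≤ quarterSqDist p := by
  unfold quarterSqDist
  positivity

lemma absLogKernel_eq (x y : EuclideanSpace ℝ (Fin n)) :
    absLogKernel x y = if x = y then ⊤ else ENNReal.ofReal |Real.log ‖x - y‖| := by
  unfold absLogKernel
  split_ifs with hxy
  · simp [hxy]
  · have h0 : 0 < ‖x - y‖ := norm_pos_iff.2 (sub_ne_zero.2 hxy)
    rw [edist_dist, dist_eq_norm, ENNReal.log_ofReal_of_pos h0]
    rfl

lemma measurable_absLogKernel : Measurable fun p : EuclideanSpace ℝ (Fin n) ×
    EuclideanSpace ℝ (Fin n) => absLogKernel p.1 p.2 := by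
  simp_rw [absLogKernel_eq]
  exact Measurable.ite measurableSet_diagonal measurable_const (by fun_prop)

/-- The logarithmic energy of the measure with density `h`, as a double integral. -/
def pairEnergy (ν : Measure (EuclideanSpace ℝ (Fin n))) (h : EuclideanSpace ℝ (Fin n) → ℂ) : ℂ :=
  ∫ p, ((Real.log (1 / ‖p.1 - p.2‖) : ℝ) : ℂ) * pairDensity h p ∂(ν.prod ν)

lemma integrable_mul_pairDensity (hm : Measurable h) (hb : ∀ x, ‖h x‖ ≤ 1)
    {g : EuclideanSpace ℝ (Fin n) × EuclideanSpace ℝ (Fin n) → ℝ} (hg : Integrable g (ν.prod ν)) :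
    Integrable (fun p => (g p : ℂ) * pairDensity h p) (ν.prod ν) :=
  hg.ofReal.mul_bdd (c := 1) (measurable_pairDensity hm).aestronglyMeasurable
    (Eventually.of_forall (norm_pairDensity_le hb))

lemma log_quarterSqDist (p : EuclideanSpace ℝ (Fin n) × EuclideanSpace ℝ (Fin n))
    (hp : p.1 ≠ p.2) :
    Real.log (quarterSqDist p) = 2 * Real.log ‖p.1 - p.2‖ - Real.log 4 := by
  have h0 : ‖p.1 - p.2‖ ≠ 0 := norm_ne_zero_iff.2 (sub_ne_zero.2 hp)
  rw [quarterSqDist, Real.log_div (by positivity) (by norm_num), Real.log_pow]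
  norm_num

lemma cintegral_congr_ae {μ : ComplexMeasure (EuclideanSpace ℝ (Fin n))} (hle : μ.variation ≤ ν)
    {f g : EuclideanSpace ℝ (Fin n) → ℂ} (hfg : f =ᵐ[ν] g) : cintegral μ f = cintegral μ g :=
  VectorMeasure.integral_congr_ae (Measure.absolutelyContinuous_of_le hle hfg)

/-- Lebesgue measure is absolutely continuous with respect to `dξ/|ξ|ⁿ`, the origin being null for
`n ≥ 1`; continuity then upgrades almost everywhere to everywhere. -/
lemma densityFourier_eq_zero (hi : Integrable h ν)
    (h0 : ∫⁻ ξ, ‖densityFourier ν h ξ‖ₑ ^ 2 ∂(invNormPowMeasure n) = 0) (hn : 1 ≤ n) :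
    densityFourier ν h = 0 := by
  have : Nonempty (Fin n) := ⟨⟨0, hn⟩⟩
  have hc := continuous_densityFourier hi
  rw [lintegral_eq_zero_iff (by fun_prop)] at h0
  have hac : (volume : Measure (EuclideanSpace ℝ (Fin n))) ≪ invNormPowMeasure n := by
    refine withDensity_absolutelyContinuous' (by fun_prop) ?_
    have h0 : ∀ᵐ ξ : EuclideanSpace ℝ (Fin n), ξ ≠ 0 := by
      simp [ae_iff]
    filter_upwards [h0] with ξ hξ
    have : 0 < ‖ξ‖ := norm_pos_iff.2 hξ
    rw [ne_eq, ENNReal.ofReal_eq_zero, not_le]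
    positivity
  refine (hc.ae_eq_iff_eq (μ := volume) continuous_const).1 ?_
  filter_upwards [hac h0] with ξ hξ
  exact enorm_eq_zero.1 (pow_eq_zero_iff two_ne_zero |>.1 hξ)

/-! ### The Fourier side: Gaussian weights and the heat energy. -/

variable [IsFiniteMeasure ν]

lemma integral_pairDensity :
    ∫ p, pairDensity h p ∂(ν.prod ν) = conj (∫ x, h x ∂ν) * ∫ x, h x ∂ν := by
  rw [← integral_conj]
  exact integral_prod_mul (fun x => conj (h x)) h

lemma normSq_densityFourier (ξ : EuclideanSpace ℝ (Fin n)) :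
    ((‖densityFourier ν h ξ‖ ^ 2 : ℝ) : ℂ) =
      ∫ p, Complex.exp (Complex.I * ((inner ℝ (p.2 - p.1) ξ : ℝ) : ℂ)) * pairDensity h p
        ∂(ν.prod ν) := by
  rw [Complex.ofReal_pow, ← Complex.conj_mul']
  rw [densityFourier, ← integral_conj, ← integral_prod_mul]
  congr 1
  ext p
  rw [pairDensity, map_mul, ← Complex.exp_conj, map_mul, Complex.conj_I, Complex.conj_ofReal,
    mul_mul_mul_comm, ← Complex.exp_add, inner_sub_left, real_inner_comm ξ p.2,
    real_inner_comm ξ p.1]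
  push_cast
  ring_nf

lemma integral_gaussian_mul_exp {t : ℝ} (ht : 0 < t) (w : EuclideanSpace ℝ (Fin n)) :
    ∫ ξ : EuclideanSpace ℝ (Fin n), (Real.exp (-t * ‖ξ‖ ^ 2) : ℂ) *
        Complex.exp (Complex.I * ((inner ℝ w ξ : ℝ) : ℂ)) =
      (((Real.pi / t) ^ ((n : ℝ) / 2) : ℝ) : ℂ) * (Real.exp (-(‖w‖ ^ 2 / 4 / t)) : ℂ) := by
  have := GaussianFourier.integral_cexp_neg_mul_sq_norm_add (V := EuclideanSpace ℝ (Fin n))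
    (b := (t : ℂ)) (by simpa using ht) Complex.I w
  rw [finrank_euclideanSpace, Fintype.card_fin] at this
  rw [Complex.ofReal_cpow (by positivity), Complex.ofReal_exp]
  push_cast
  rw [show (-(((‖w‖ : ℝ) : ℂ) ^ 2 / 4 / (t : ℂ))) =
    Complex.I ^ 2 * ((‖w‖ : ℝ) : ℂ) ^ 2 / (4 * (t : ℂ)) by
      rw [Complex.I_sq]; ring, ← this]
  congr 1
  ext ξ
  rw [← Complex.exp_add]

lemma integrable_gaussian {t : ℝ} (ht : 0 < t) :
    Integrable (fun ξ : EuclideanSpace ℝ (Fin n) => Real.exp (-t * ‖ξ‖ ^ 2)) := by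
  refine (GaussianFourier.integrable_cexp_neg_mul_sq_norm_add
    (V := EuclideanSpace ℝ (Fin n)) (b := (t : ℂ)) (by simpa using ht) 0 0).norm.congr
    (Eventually.of_forall fun ξ => ?_)
  beta_reduce
  rw [Complex.norm_exp, zero_mul, add_zero]
  norm_cast

lemma integral_gaussian_mul_normSq (hm : Measurable h) (hb : ∀ x, ‖h x‖ ≤ 1) {t : ℝ}
    (ht : 0 < t) :
    ((∫ ξ, Real.exp (-t * ‖ξ‖ ^ 2) * ‖densityFourier ν h ξ‖ ^ 2 : ℝ) : ℂ) =
      (((Real.pi / t) ^ ((n : ℝ) / 2) : ℝ) : ℂ) * heatEnergy ν h t := by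
  rw [← integral_complex_ofReal]
  have hg := integrable_gaussian (n := n) ht
  have hint : Integrable (fun q : EuclideanSpace ℝ (Fin n) ×
      (EuclideanSpace ℝ (Fin n) × EuclideanSpace ℝ (Fin n)) =>
      (Real.exp (-t * ‖q.1‖ ^ 2) : ℂ) *
        (Complex.exp (Complex.I * ((inner ℝ (q.2.2 - q.2.1) q.1 : ℝ) : ℂ)) *
          pairDensity h q.2)) (volume.prod (ν.prod ν)) := by
    refine (hg.mul_prod (integrable_const (1 : ℝ))).mono' ?_
      (Eventually.of_forall fun q => ?_)
    · refine (Measurable.mul (by fun_prop) (Measurable.mul (by fun_prop)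
        ((measurable_pairDensity hm).comp measurable_snd))).aestronglyMeasurable
    · rw [norm_mul, norm_mul, norm_exp_I_mul_ofReal, one_mul, Complex.norm_real,
        Real.norm_of_nonneg (Real.exp_pos _).le]
      gcongr
      exact norm_pairDensity_le hb _
  simp_rw [Complex.ofReal_mul, normSq_densityFourier, ← integral_const_mul]
  rw [integral_integral_swap hint, heatEnergy, ← integral_const_mul]
  congr 1
  ext p
  simp_rw [← mul_assoc]
  rw [integral_mul_const, integral_gaussian_mul_exp ht, quarterSqDist, norm_sub_rev]

/-- Up to a positive factor, the heat energy is the integral of `|μ̂|²` against a Gaussian. -/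
lemma heatEnergy_eq_ofReal (hm : Measurable h) (hb : ∀ x, ‖h x‖ ≤ 1) {t : ℝ} (ht : 0 < t) :
    heatEnergy ν h t = ((heatEnergy ν h t).re : ℂ) ∧ 0 ≤ (heatEnergy ν h t).re ∧
    ∫ ξ, Real.exp (-t * ‖ξ‖ ^ 2) * ‖densityFourier ν h ξ‖ ^ 2 =
      (Real.pi / t) ^ ((n : ℝ) / 2) * (heatEnergy ν h t).re := by
  have key := integral_gaussian_mul_normSq (ν := ν) hm hb ht
  have hc : 0 < (Real.pi / t) ^ ((n : ℝ) / 2) := by positivity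
  have h0 : 0 ≤ ∫ ξ, Real.exp (-t * ‖ξ‖ ^ 2) * ‖densityFourier ν h ξ‖ ^ 2 :=
    integral_nonneg fun ξ => by positivity
  have hre := congrArg Complex.re key
  have him := congrArg Complex.im key
  rw [Complex.ofReal_re, Complex.re_ofReal_mul] at hre
  rw [Complex.ofReal_im, Complex.im_ofReal_mul, eq_comm, mul_eq_zero] at him
  refine ⟨?_, ?_, hre⟩
  · exact Complex.ext rfl (by simpa using him.resolve_left hc.ne')
  · rw [hre] at h0
    exact nonneg_of_mul_nonneg_right h0 hc

lemma ofReal_inv_norm_pow (hn : 1 ≤ n) {r : ℝ} (hr : 0 < r) :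
    ENNReal.ofReal (1 / r ^ n) = ∫⁻ t in Ioi (0 : ℝ),
      ENNReal.ofReal ((Real.Gamma ((n : ℝ) / 2))⁻¹ * t ^ ((n : ℝ) / 2 - 1) *
        Real.exp (-t * r ^ 2)) := by
  have hn' : (0 : ℝ) < (n : ℝ) / 2 := by positivity
  have hG := Real.Gamma_pos_of_pos hn'
  have key := Real.integral_rpow_mul_exp_neg_mul_Ioi hn' (pow_pos hr 2)
  have hpos : 0 < (1 / r ^ 2) ^ ((n : ℝ) / 2) * Real.Gamma ((n : ℝ) / 2) := by positivity
  have hi : IntegrableOn (fun t : ℝ => t ^ ((n : ℝ) / 2 - 1) * Real.exp (-(r ^ 2 * t))) (Ioi 0) := by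
    -- A non-integrable function has integral `0` by convention, which contradicts the positive
    -- value in `key`.
    by_contra hcon
    rw [integral_undef hcon] at key
    exact hpos.ne key
  have e : (fun t : ℝ => (Real.Gamma ((n : ℝ) / 2))⁻¹ * t ^ ((n : ℝ) / 2 - 1) *
      Real.exp (-t * r ^ 2)) = fun t => (Real.Gamma ((n : ℝ) / 2))⁻¹ *
      (t ^ ((n : ℝ) / 2 - 1) * Real.exp (-(r ^ 2 * t))) := by
    ext t
    rw [mul_assoc, neg_mul, mul_comm t]
  rw [← ofReal_integral_eq_lintegral_ofReal]
  · rw [e, integral_const_mul, key]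
    congr 1
    rw [one_div, one_div, Real.inv_rpow (by positivity), ← Real.rpow_natCast r 2, ← Real.rpow_mul hr.le]
    rw [show ((2 : ℕ) : ℝ) * ((n : ℝ) / 2) = n by push_cast; ring, Real.rpow_natCast]
    field_simp
  · rw [e]
    exact hi.const_mul _
  · refine ae_restrict_of_forall_mem measurableSet_Ioi fun t (ht : 0 < t) => ?_
    simp only [Pi.zero_apply]
    positivity

/-- Tonelli needs neither zero mass nor finite energy, so the identity serves both directions of the
equivalence. -/
lemma lintegral_densityFourier (hn : 1 ≤ n) (hm : Measurable h) (hb : ∀ x, ‖h x‖ ≤ 1) :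
    ∫⁻ ξ, ‖densityFourier ν h ξ‖ₑ ^ 2 ∂(invNormPowMeasure n) =
      ∫⁻ t in Ioi (0 : ℝ), ENNReal.ofReal (Real.pi ^ ((n : ℝ) / 2) / Real.Gamma ((n : ℝ) / 2) *
        (t⁻¹ * (heatEnergy ν h t).re)) := by
  have hi : Integrable h ν := Integrable.of_bound hm.aestronglyMeasurable 1
    (Eventually.of_forall hb)
  have hc := continuous_densityFourier hi
  have : Nonempty (Fin n) := ⟨⟨0, hn⟩⟩
  have hn' : (0 : ℝ) < (n : ℝ) / 2 := by positivity
  have hG := Real.Gamma_pos_of_pos hn'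
  have hG' : Measurable fun p : EuclideanSpace ℝ (Fin n) × ℝ =>
      ENNReal.ofReal ((Real.Gamma ((n : ℝ) / 2))⁻¹ * p.2 ^ ((n : ℝ) / 2 - 1) *
        Real.exp (-p.2 * ‖p.1‖ ^ 2)) * ‖densityFourier ν h p.1‖ₑ ^ 2 := by
    have := hc.measurable
    fun_prop
  rw [invNormPowMeasure, lintegral_withDensity_eq_lintegral_mul₀ (by fun_prop) (by fun_prop)]
  calc _ = ∫⁻ ξ, ∫⁻ t in Ioi (0 : ℝ),
      ENNReal.ofReal ((Real.Gamma ((n : ℝ) / 2))⁻¹ * t ^ ((n : ℝ) / 2 - 1) *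
        Real.exp (-t * ‖ξ‖ ^ 2)) * ‖densityFourier ν h ξ‖ₑ ^ 2 := by
        apply lintegral_congr_ae
        have h0 : ∀ᵐ ξ : EuclideanSpace ℝ (Fin n), ξ ≠ 0 := by
          simp [ae_iff]
        filter_upwards [h0] with ξ hξ
        rw [Pi.mul_apply, ofReal_inv_norm_pow hn (norm_pos_iff.2 hξ), lintegral_mul_const]
        fun_prop
    _ = ∫⁻ t in Ioi (0 : ℝ), ∫⁻ ξ,
      ENNReal.ofReal ((Real.Gamma ((n : ℝ) / 2))⁻¹ * t ^ ((n : ℝ) / 2 - 1) *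
        Real.exp (-t * ‖ξ‖ ^ 2)) * ‖densityFourier ν h ξ‖ₑ ^ 2 :=
        lintegral_lintegral_swap hG'.aemeasurable
    _ = _ := by
        refine setLIntegral_congr_fun measurableSet_Ioi fun t (ht : 0 < t) => ?_
        have hk := (heatEnergy_eq_ofReal (ν := ν) hm hb ht).2.2
        have hbd : ∀ ξ, ‖densityFourier ν h ξ‖ ≤ ∫ x, ‖h x‖ ∂ν := fun ξ => by
          refine (norm_integral_le_integral_norm _).trans_eq ?_
          simp_rw [norm_mul, norm_exp_I_mul_ofReal, one_mul]
        have hg := integrable_gaussian (n := n) ht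
        have hint : Integrable fun ξ => Real.exp (-t * ‖ξ‖ ^ 2) * ‖densityFourier ν h ξ‖ ^ 2 :=
          hg.mul_bdd (c := (∫ x, ‖h x‖ ∂ν) ^ 2) (by fun_prop)
            (Eventually.of_forall fun ξ => by
              rw [norm_pow, norm_norm]
              exact pow_le_pow_left₀ (norm_nonneg _) (hbd ξ) 2)
        have e : ∀ ξ, ENNReal.ofReal ((Real.Gamma ((n : ℝ) / 2))⁻¹ * t ^ ((n : ℝ) / 2 - 1) *
            Real.exp (-t * ‖ξ‖ ^ 2)) * ‖densityFourier ν h ξ‖ₑ ^ 2 =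
            ENNReal.ofReal ((Real.Gamma ((n : ℝ) / 2))⁻¹ * t ^ ((n : ℝ) / 2 - 1) *
              (Real.exp (-t * ‖ξ‖ ^ 2) * ‖densityFourier ν h ξ‖ ^ 2)) := fun ξ => by
          rw [← mul_assoc, ENNReal.ofReal_mul (p := _ * _ * _) (by positivity),
            ENNReal.ofReal_pow (norm_nonneg _), ofReal_norm]
        simp only [e]
        rw [← ofReal_integral_eq_lintegral_ofReal (hint.const_mul _)
          (Eventually.of_forall fun ξ => by simp only [Pi.zero_apply]; positivity),
          integral_const_mul, hk, Real.div_rpow Real.pi_pos.le ht.le, Real.rpow_sub ht, Real.rpow_one]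
        congr 1
        have := (Real.rpow_pos_of_pos ht ((n : ℝ) / 2)).ne'
        field_simp

/-! ### The logarithmic side: integrating the heat energy over time. -/

lemma ae_ne_and_integrable_log
    (hL : ∫⁻ x, ∫⁻ y, absLogKernel x y ∂ν ∂ν < ⊤) :
    (∀ᵐ p ∂(ν.prod ν), p.1 ≠ p.2) ∧
      Integrable (fun p : EuclideanSpace ℝ (Fin n) × EuclideanSpace ℝ (Fin n) =>
        Real.log ‖p.1 - p.2‖) (ν.prod ν) := by
  have hL' : ∫⁻ p, absLogKernel p.1 p.2 ∂(ν.prod ν) < ⊤ := by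
    rwa [lintegral_prod _ measurable_absLogKernel.aemeasurable]
  have hne : ∀ᵐ p ∂(ν.prod ν), p.1 ≠ p.2 := by
    filter_upwards [ae_lt_top measurable_absLogKernel hL'.ne] with p hp hp'
    rw [absLogKernel_eq, if_pos hp'] at hp
    exact lt_irrefl _ hp
  refine ⟨hne, Measurable.aestronglyMeasurable (by fun_prop), ?_⟩
  rw [hasFiniteIntegral_iff_norm]
  refine (lintegral_congr_ae ?_).trans_lt hL'
  filter_upwards [hne] with p hp
  rw [absLogKernel_eq, if_neg hp, Real.norm_eq_abs]

/-- The `L¹` norm in `t` grows only like `|ln |x-y||`, which finite energy makes integrable over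
pairs. -/
lemma integrable_cutKernel_prod (hm : Measurable h) (hb : ∀ x, ‖h x‖ ≤ 1)
    (hL : ∫⁻ x, ∫⁻ y, absLogKernel x y ∂ν ∂ν < ⊤) :
    Integrable (fun q : (EuclideanSpace ℝ (Fin n) × EuclideanSpace ℝ (Fin n)) × ℝ =>
      (cutKernel (quarterSqDist q.1) q.2 : ℂ) * pairDensity h q.1)
      ((ν.prod ν).prod (volume.restrict (Ioi 0))) := by
  obtain ⟨hne, hlog⟩ := ae_ne_and_integrable_log hL
  have hmeas : AEStronglyMeasurable
      (fun q : (EuclideanSpace ℝ (Fin n) × EuclideanSpace ℝ (Fin n)) × ℝ =>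
      (cutKernel (quarterSqDist q.1) q.2 : ℂ) * pairDensity h q.1)
      ((ν.prod ν).prod (volume.restrict (Ioi 0))) := by
    have h1 : Measurable fun q : (EuclideanSpace ℝ (Fin n) × EuclideanSpace ℝ (Fin n)) × ℝ =>
        cutKernel (quarterSqDist q.1) q.2 :=
      measurable_cutKernel.comp ((measurable_quarterSqDist.comp measurable_fst).prodMk
        measurable_snd)
    exact ((Complex.measurable_ofReal.comp h1).mul
      ((measurable_pairDensity hm).comp measurable_fst)).aestronglyMeasurable
  have hpos : ∀ p : EuclideanSpace ℝ (Fin n) × EuclideanSpace ℝ (Fin n), p.1 ≠ p.2 →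
      0 < quarterSqDist p := fun p hp => by
    have : 0 < ‖p.1 - p.2‖ := norm_pos_iff.2 (sub_ne_zero.2 hp)
    unfold quarterSqDist
    positivity
  rw [integrable_prod_iff hmeas]
  constructor
  · filter_upwards [hne] with p hp
    exact (integrableOn_cutKernel (hpos p hp)).ofReal.mul_const _
  · refine Integrable.mono' (g := fun p => (∫ t in Ioi 0, ‖cutKernel 1 t‖) +
      |2 * Real.log ‖p.1 - p.2‖ - Real.log 4|) ?_ hmeas.norm.integral_prod_right' ?_
    · exact (integrable_const _).add ((hlog.const_mul 2).sub (integrable_const _)).abs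
    · filter_upwards [hne] with p hp
      rw [Real.norm_of_nonneg (integral_nonneg fun t => norm_nonneg _)]
      simp_rw [norm_mul, Complex.norm_real]
      rw [integral_mul_const, ← log_quarterSqDist p hp]
      refine (mul_le_of_le_one_right (integral_nonneg fun t => norm_nonneg _)
        (norm_pairDensity_le hb p)).trans (integral_norm_cutKernel_le (hpos p hp))

lemma integrable_exp_quarterSqDist {t : ℝ} (ht : 0 < t) :
    Integrable (fun p => Real.exp (-(quarterSqDist p / t))) (ν.prod ν) := by
  refine Integrable.of_bound (by fun_prop) 1 (Eventually.of_forall fun p => ?_)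
  rw [Real.norm_of_nonneg (Real.exp_pos _).le, Real.exp_le_one_iff, neg_nonpos]
  exact div_nonneg (quarterSqDist_nonneg p) ht.le

/-- The cutoff does not depend on the pair, so zero mass annihilates its contribution. -/
lemma integral_cutKernel_pair (hm : Measurable h) (hb : ∀ x, ‖h x‖ ≤ 1) (h0 : ∫ x, h x ∂ν = 0)
    {t : ℝ} (ht : 0 < t) :
    ∫ p, (cutKernel (quarterSqDist p) t : ℂ) * pairDensity h p ∂(ν.prod ν) =
      (t⁻¹ : ℝ) * heatEnergy ν h t := by
  have h1 : ∫ p, pairDensity h p ∂(ν.prod ν) = 0 := by rw [integral_pairDensity, h0, mul_zero]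
  have hW : Integrable (pairDensity h) (ν.prod ν) := by
    simpa using integrable_mul_pairDensity (ν := ν) hm hb (integrable_const 1)
  set c : ℝ := if 1 < t then 1 else 0 with hc
  have e : ∀ p : EuclideanSpace ℝ (Fin n) × EuclideanSpace ℝ (Fin n),
      (cutKernel (quarterSqDist p) t : ℂ) * pairDensity h p =
      (t⁻¹ : ℝ) * ((Real.exp (-(quarterSqDist p / t)) : ℂ) * pairDensity h p -
        (c : ℂ) * pairDensity h p) := fun p => by
    rw [cutKernel, ← hc, Complex.ofReal_mul, Complex.ofReal_sub]
    ring
  simp_rw [e]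
  rw [integral_const_mul, integral_sub
    (integrable_mul_pairDensity hm hb (integrable_exp_quarterSqDist ht)) (hW.const_mul _),
    integral_const_mul, h1, mul_zero, sub_zero, heatEnergy]

lemma integrable_heatEnergy (hm : Measurable h) (hb : ∀ x, ‖h x‖ ≤ 1)
    (hL : ∫⁻ x, ∫⁻ y, absLogKernel x y ∂ν ∂ν < ⊤) (h0 : ∫ x, h x ∂ν = 0) :
    IntegrableOn (fun t : ℝ => (t⁻¹ : ℝ) * heatEnergy ν h t) (Ioi 0) ∧
      ∫ t in Ioi (0 : ℝ), (t⁻¹ : ℝ) * heatEnergy ν h t = 2 * pairEnergy ν h := by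
  have hH := integrable_cutKernel_prod hm hb hL
  obtain ⟨hne, hlog⟩ := ae_ne_and_integrable_log hL
  have h1 : ∫ p, pairDensity h p ∂(ν.prod ν) = 0 := by rw [integral_pairDensity, h0, mul_zero]
  have hW : Integrable (pairDensity h) (ν.prod ν) := by
    simpa using integrable_mul_pairDensity (ν := ν) hm hb (integrable_const 1)
  have e : ∀ t ∈ Ioi (0 : ℝ), ∫ p, (cutKernel (quarterSqDist p) t : ℂ) * pairDensity h p
      ∂(ν.prod ν) = (t⁻¹ : ℝ) * heatEnergy ν h t := fun t ht => integral_cutKernel_pair hm hb h0 ht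
  refine ⟨IntegrableOn.congr_fun hH.integral_prod_right e measurableSet_Ioi, ?_⟩
  rw [← setIntegral_congr_fun measurableSet_Ioi e, ← integral_integral_swap hH]
  -- `C` collects what does not depend on the pair, including `log 4` from `|x-y|²/4`; it is killed
  -- by zero mass. The square produces the factor `2`.
  set C : ℝ := (∫ t in Ioi 0, cutKernel 1 t) + Real.log 4
  have e2 : (fun p => ∫ t in Ioi (0 : ℝ), (cutKernel (quarterSqDist p) t : ℂ) * pairDensity h p)
      =ᵐ[ν.prod ν] fun p => (C : ℂ) * pairDensity h p +
        2 * (((Real.log (1 / ‖p.1 - p.2‖) : ℝ) : ℂ) * pairDensity h p) := by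
    filter_upwards [hne] with p hp
    have hpos : 0 < quarterSqDist p := by
      have : 0 < ‖p.1 - p.2‖ := norm_pos_iff.2 (sub_ne_zero.2 hp)
      unfold quarterSqDist
      positivity
    rw [integral_mul_const, integral_complex_ofReal, integral_cutKernel hpos, log_quarterSqDist p hp,
      one_div, Real.log_inv]
    simp only [C]
    push_cast
    ring
  have hlog' : Integrable (fun p : EuclideanSpace ℝ (Fin n) × EuclideanSpace ℝ (Fin n) =>
      Real.log (1 / ‖p.1 - p.2‖)) (ν.prod ν) := by
    simpa only [one_div, Real.log_inv] using! hlog.neg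
  rw [integral_congr_ae e2, integral_add (hW.const_mul _)
    ((integrable_mul_pairDensity hm hb hlog').const_mul _), integral_const_mul, h1, mul_zero,
    zero_add, integral_const_mul, pairEnergy]

/-! ### Large times: finiteness forces zero mass. -/

lemma tendsto_heatEnergy (hm : Measurable h) (hb : ∀ x, ‖h x‖ ≤ 1) :
    Tendsto (heatEnergy ν h) atTop (𝓝 (conj (∫ x, h x ∂ν) * ∫ x, h x ∂ν)) := by
  rw [← integral_pairDensity]
  refine tendsto_integral_filter_of_dominated_convergence (fun _ => 1) ?_ ?_ (integrable_const _) ?_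
  · filter_upwards with t
    exact (Measurable.mul (by fun_prop) (measurable_pairDensity hm)).aestronglyMeasurable
  · filter_upwards [eventually_gt_atTop 0] with t ht
    filter_upwards with p
    rw [norm_mul, Complex.norm_real, Real.norm_of_nonneg (Real.exp_pos _).le]
    refine mul_le_one₀ ?_ (norm_nonneg _) (norm_pairDensity_le hb p)
    rw [Real.exp_le_one_iff, neg_nonpos]
    exact div_nonneg (quarterSqDist_nonneg p) ht.le
  · filter_upwards with p
    have h1 : Tendsto (fun t : ℝ => Real.exp (-(quarterSqDist p / t))) atTop (𝓝 1) := by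
      have := (Real.continuous_exp.tendsto _).comp
        ((tendsto_const_nhds (x := quarterSqDist p)).div_atTop (tendsto_id (α := ℝ))).neg
      simpa using! this
    simpa using ((Complex.continuous_ofReal.tendsto _).comp h1).mul_const (pairDensity h p)

lemma integral_eq_zero_of_lintegral_heatEnergy_lt_top (hm : Measurable h) (hb : ∀ x, ‖h x‖ ≤ 1)
    {C : ℝ} (hC : 0 < C)
    (hfin : ∫⁻ t in Ioi (0 : ℝ), ENNReal.ofReal (C * (t⁻¹ * (heatEnergy ν h t).re)) < ⊤) :
    ∫ x, h x ∂ν = 0 := by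
  by_contra hne
  have hlim := (Complex.continuous_re.tendsto _).comp (tendsto_heatEnergy (ν := ν) hm hb)
  rw [Complex.conj_mul'] at hlim
  norm_cast at hlim
  set l := ‖∫ x, h x ∂ν‖ ^ 2
  have hl : 0 < l := by positivity
  -- Past `T` the heat energy exceeds `l / 2`, half its limit, so the integrand dominates a multiple
  -- of `1/t`, which is not integrable at infinity.
  obtain ⟨T, hT, hT0⟩ := ((hlim.eventually (lt_mem_nhds (half_lt_self hl))).and
    (eventually_ge_atTop 0)).exists_forall_of_atTop.imp fun T hT =>
      (⟨fun t ht => (hT t ht).1, (hT T le_rfl).2⟩ : (∀ t ≥ T, l / 2 < (heatEnergy ν h t).re) ∧ 0 ≤ T)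
  apply not_integrableOn_Ioi_inv (a := T)
  have hint : IntegrableOn (fun t : ℝ => C * (l / 2) * t⁻¹) (Ioi T) := by
    refine ⟨by fun_prop, ?_⟩
    rw [hasFiniteIntegral_iff_norm]
    refine lt_of_le_of_lt ?_ hfin
    refine le_trans ?_ (lintegral_mono_set (Ioi_subset_Ioi hT0))
    refine setLIntegral_mono_ae' measurableSet_Ioi (Eventually.of_forall fun t ht => ?_)
    have ht0 : 0 < t := hT0.trans_lt ht
    rw [Real.norm_of_nonneg (by positivity), mul_assoc, mul_comm (l / 2)]
    gcongr
    exact (hT t (le_of_lt ht)).le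
  have := hint.const_mul (C * (l / 2))⁻¹
  refine this.congr (Eventually.of_forall fun t => ?_)
  beta_reduce
  rw [← mul_assoc, inv_mul_cancel₀ (by positivity), one_mul]

/-! ### The energy identity and positive definiteness. -/

lemma logEnergy_withDensityᵥ (hm : Measurable h) (hb : ∀ x, ‖h x‖ ≤ 1)
    (hL : ∫⁻ x, ∫⁻ y, absLogKernel x y ∂ν ∂ν < ⊤) :
    logEnergy (ν.withDensityᵥ h) = pairEnergy ν h := by
  have hi : Integrable h ν := Integrable.of_bound hm.aestronglyMeasurable 1
    (Eventually.of_forall hb)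
  have hm' : Measurable fun x => conj (h x) := Complex.continuous_conj.measurable.comp hm
  have hb' : ∀ x, ‖conj (h x)‖ ≤ 1 := fun x => by rw [RCLike.norm_conj]; exact hb x
  have hi' : Integrable (fun x => conj (h x)) ν := Integrable.of_bound hm'.aestronglyMeasurable 1
    (Eventually.of_forall hb')
  have hlog' : Integrable (fun p : EuclideanSpace ℝ (Fin n) × EuclideanSpace ℝ (Fin n) =>
      Real.log (1 / ‖p.1 - p.2‖)) (ν.prod ν) := by
    simpa only [one_div, Real.log_inv] using! (ae_ne_and_integrable_log hL).2.neg
  have hlogh : Integrable (fun p : EuclideanSpace ℝ (Fin n) × EuclideanSpace ℝ (Fin n) =>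
      ((Real.log (1 / ‖p.1 - p.2‖) : ℝ) : ℂ) * h p.2) (ν.prod ν) :=
    hlog'.ofReal.mul_bdd (c := 1) (hm.comp measurable_snd).aestronglyMeasurable
      (Eventually.of_forall fun p => hb p.2)
  -- The potential converges absolutely only for `ν`-almost every `x`; this suffices, since the
  -- variation of the conjugate measure is at most `ν`.
  have hpot : logPotential (ν.withDensityᵥ h) =ᵐ[ν]
      fun x => ∫ y, ((Real.log (1 / ‖x - y‖) : ℝ) : ℂ) * h y ∂ν := by
    filter_upwards [hlog'.ofReal (𝕜 := ℂ) |>.prod_right_ae] with x hx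
    exact integral_withDensityᵥ hm hb hx
  have hconj : conjMeasure (ν.withDensityᵥ h) = ν.withDensityᵥ fun x => conj (h x) :=
    conj_withDensityᵥ hi
  rw [logEnergy, hconj, cintegral_congr_ae (variation_withDensityᵥ_le hi' hb') hpot]
  refine (integral_withDensityᵥ hm' hb' hlogh.integral_prod_left).trans ?_
  rw [pairEnergy, integral_prod _ (integrable_mul_pairDensity hm hb hlog')]
  congr 1
  ext x
  rw [← integral_mul_const]
  congr 1
  ext y
  simp only [pairDensity]
  ring

lemma lintegral_densityFourier_eq_pairEnergy (hn : 1 ≤ n) (hm : Measurable h) (hb : ∀ x, ‖h x‖ ≤ 1)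
    (hL : ∫⁻ x, ∫⁻ y, absLogKernel x y ∂ν ∂ν < ⊤) (h0 : ∫ x, h x ∂ν = 0) :
    pairEnergy ν h = ((pairEnergy ν h).re : ℂ) ∧ 0 ≤ (pairEnergy ν h).re ∧
    ∫⁻ ξ, ‖densityFourier ν h ξ‖ₑ ^ 2 ∂(invNormPowMeasure n) =
      ENNReal.ofReal (sphereArea n * (pairEnergy ν h).re) := by
  obtain ⟨hint, heq⟩ := integrable_heatEnergy hm hb hL h0
  have hn' : (0 : ℝ) < (n : ℝ) / 2 := by positivity
  have hG := Real.Gamma_pos_of_pos hn'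
  have e : ∀ t ∈ Ioi (0 : ℝ), ((t⁻¹ : ℝ) : ℂ) * heatEnergy ν h t =
      ((t⁻¹ * (heatEnergy ν h t).re : ℝ) : ℂ) := fun t ht => by
    rw [(heatEnergy_eq_ofReal (ν := ν) hm hb ht).1]
    push_cast
    simp
  have hint' : IntegrableOn (fun t : ℝ => t⁻¹ * (heatEnergy ν h t).re) (Ioi 0) :=
    IntegrableOn.congr_fun hint.re (fun t ht => by
      change (((t⁻¹ : ℝ) : ℂ) * heatEnergy ν h t).re = _
      rw [Complex.re_ofReal_mul]) measurableSet_Ioi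
  rw [setIntegral_congr_fun measurableSet_Ioi e, integral_complex_ofReal] at heq
  have hnn : ∀ t ∈ Ioi (0 : ℝ), 0 ≤ t⁻¹ * (heatEnergy ν h t).re := fun t ht =>
    mul_nonneg (inv_nonneg.2 (le_of_lt ht)) (heatEnergy_eq_ofReal (ν := ν) hm hb ht).2.1
  have hre : ∫ t in Ioi (0 : ℝ), t⁻¹ * (heatEnergy ν h t).re = 2 * (pairEnergy ν h).re := by
    have := congrArg Complex.re heq
    simpa using this
  refine ⟨?_, ?_, ?_⟩
  · refine Complex.ext (Complex.ofReal_re _).symm ?_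
    have := congrArg Complex.im heq
    simpa using this.symm
  · have := setIntegral_nonneg measurableSet_Ioi hnn (μ := volume)
    linarith
  · rw [lintegral_densityFourier hn hm hb, ← ofReal_integral_eq_lintegral_ofReal
      (hint'.const_mul _), integral_const_mul, hre, sphereArea]
    · congr 1
      ring
    · refine ae_restrict_of_forall_mem measurableSet_Ioi fun t ht => ?_
      exact mul_nonneg (by positivity) (hnn t ht)

lemma sphereArea_pos (hn : 1 ≤ n) : 0 < sphereArea n := by
  have hG := Real.Gamma_pos_of_pos (show (0 : ℝ) < (n : ℝ) / 2 by positivity)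
  unfold sphereArea
  positivity

lemma eLpNorm_two_sq {α : Type*} [MeasurableSpace α] (f : α → ℂ) (ρ : Measure α) :
    eLpNorm f 2 ρ ^ 2 = ∫⁻ x, ‖f x‖ₑ ^ 2 ∂ρ := by
  have := eLpNorm_nnreal_pow_eq_lintegral (f := f) (μ := ρ) (p := 2) (by norm_num)
  simpa using! this

end LogEnergy

end

open LogEnergy

theorem mainTheorem3 (n : ℕ) (hn : 1 ≤ n)
    (μ : MeasureTheory.ComplexMeasure (EuclideanSpace ℝ (Fin n))) (hμ : μ ∈ LogEnergy.M0 n) :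
    (MeasureTheory.MemLp (LogEnergy.fourierTransform μ) 2 (LogEnergy.invNormPowMeasure n) ↔
      μ ∈ LogEnergy.M00 n) ∧
    (μ ∈ LogEnergy.M00 n →
      (LogEnergy.sphereArea n : ℂ) * LogEnergy.logEnergy μ =
        (((MeasureTheory.eLpNorm (LogEnergy.fourierTransform μ) 2
          (LogEnergy.invNormPowMeasure n)).toReal ^ 2 : ℝ) : ℂ) ∧
      (LogEnergy.logEnergy μ).im = 0 ∧
      0 ≤ (LogEnergy.logEnergy μ).re ∧
      (LogEnergy.logEnergy μ = 0 ↔ μ = 0)) := by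
  obtain ⟨hfin, h, hm, hb, hμh⟩ := exists_polar_decomposition μ
  have hi : Integrable h μ.variation := Integrable.of_bound hm.aestronglyMeasurable 1
    (Filter.Eventually.of_forall hb)
  have hL : ∫⁻ x, ∫⁻ y, absLogKernel x y ∂μ.variation ∂μ.variation < ⊤ := hμ
  have hF : fourierTransform μ = densityFourier μ.variation h := by
    conv_lhs => rw [hμh]
    exact fourierTransform_withDensityᵥ hm hb
  have hI : logEnergy μ = pairEnergy μ.variation h := by
    conv_lhs => rw [hμh]
    exact logEnergy_withDensityᵥ hm hb hL
  have hmass : μ Set.univ = ∫ x, h x ∂μ.variation := by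
    conv_lhs => rw [hμh]
    rw [withDensityᵥ_apply hi MeasurableSet.univ, setIntegral_univ]
  have hG := Real.Gamma_pos_of_pos (show (0 : ℝ) < (n : ℝ) / 2 by positivity)
  have hmem : μ ∈ M00 n ↔ ∫ x, h x ∂μ.variation = 0 := by
    rw [← hmass]
    exact ⟨fun h => h.2, fun h => ⟨hμ, h⟩⟩
  have hc := continuous_densityFourier hi
  rw [hF, hI, hmem]
  refine ⟨⟨fun hmemLp => ?_, fun h0 => ⟨hc.aestronglyMeasurable, ?_⟩⟩, fun h0 => ?_⟩
  · refine integral_eq_zero_of_lintegral_heatEnergy_lt_top (ν := μ.variation) hm hb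
      (C := Real.pi ^ ((n : ℝ) / 2) / Real.Gamma ((n : ℝ) / 2)) (by positivity) ?_
    rw [← lintegral_densityFourier hn hm hb, ← eLpNorm_two_sq]
    exact ENNReal.pow_lt_top hmemLp.2
  · have := (lintegral_densityFourier_eq_pairEnergy hn hm hb hL h0).2.2
    rw [← eLpNorm_two_sq] at this
    -- An infinite norm would have infinite square, whereas the square is `ENNReal.ofReal` of a real
    -- number.
    by_contra hcon
    rw [not_lt_top_iff.1 hcon] at this
    simp at this
  · obtain ⟨hreal, hnn, hlin⟩ := lintegral_densityFourier_eq_pairEnergy hn hm hb hL h0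
    refine ⟨?_, ?_, hnn, fun hz => ?_, fun hz => ?_⟩
    · rw [← ENNReal.toReal_pow, eLpNorm_two_sq, hlin,
        ENNReal.toReal_ofReal (mul_nonneg (sphereArea_pos hn).le hnn), Complex.ofReal_mul, ← hreal]
    · rw [hreal, Complex.ofReal_im]
    · rw [hz, Complex.zero_re, mul_zero, ENNReal.ofReal_zero] at hlin
      have hh := ae_eq_zero_of_densityFourier_eq_zero hi
        (congrFun (densityFourier_eq_zero hi hlin hn))
      rw [hμh, WithDensityᵥEq.congr_ae hh, withDensityᵥ_zero]
    · have : μ.variation = 0 := by rw [hz, VectorMeasure.variation_zero]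
      rw [pairEnergy, this, Measure.prod_zero, integral_zero_measure]
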